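/- **Setting.** A half-line Maya diagram (of finite energy) places a black or a white stone on each site $0,1,2,\ldots$, with only finitely many white stones; it is labelled by the positions $0\le j_1<j_2<\cdots$ of its black stones. The neutral-fermion Fock space $\mathcal F$ is the complex vector space with basis the states $|j_1,j_2,\ldots\rangle$; the initial vacuum is $|0\rangle=|0,1,2,\ldots\rangle$, and $\langle 0|$ is the linear functional on $\mathcal F$ taking the coefficient of $|0\rangle$. The neutral fermions $\phi_m$, $m\in\mathbb Z$, act on $\mathcal F$ by - for $m>0$: $\phi_m|j_1,j_2,\ldots\rangle=(-1)^{m+k-1}|j_1,\ldots,j_{k-1},j_{k+1},\ldots\rangle$ if $m=j_k$ for some $k$, and $0$ otherwise; - for $m<0$: $\phi_m|j_1,j_2,\ldots\rangle=(-1)^{k}|j_1,\ldots,j_k,-m,j_{k+1},\ldots\rangle$ if $j_k<-m<j_{k+1}$ for some $k\ge0$ (with no lower bound when $k=0$), and $0$ otherwise; - $\phi_0|j_1,j_2,\ldots\rangle=\tfrac1{\sqrt2}|0,j_1,j_2,\ldots\rangle$ if $j_1\neq0$, and $\tfrac1{\sqrt2}|j_2,j_3,\ldots\rangle$ if $j_1=0$.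 They satisfy $\phi_m\phi_n+\phi_n\phi_m=(-1)^m\delta_{m+n,0}$. For odd $m\in\mathbb Z$ put $\lambda_m=\frac12\sum_{j\in\mathbb Z}(-1)^{j+1}\phi_j\phi_{-j-m}$ (a finite sum on each basis state), and, for an indeterminate $z$, define the formal series with operator coefficients $$\widehat\Gamma_+(z)=\exp\Bigl(\sum_{m>0\text{ odd}}\tfrac2m z^{-m}\lambda_m\Bigr),\qquad \widehat\Gamma_-(z)=\exp\Bigl(\sum_{m>0\text{ odd}}\tfrac2m z^{m}\lambda_{-m}\Bigr).$$ A strict partition $\widehat\mu$ is a finite set of distinct positive integers (its nonzero parts), possibly empty; $n(\widehat\mu)$ is the number of nonzero parts and $|\widehat\mu|$ is their sum. Adding one zero part if $n(\widehat\mu)$ is odd, write $\widehat\mu=\{m_1>\cdots>m_{2r}\ge0\}$, let $\alpha_{\widehat\mu}=\sqrt2$ if a zero part was added and $\alpha_{\widehat\mu}=1$ otherwise, and set $$|\widehat\mu\rangle=\alpha_{\widehat\mu}(-1)^r\phi_{m_1}\cdots\phi_{m_{2r}}|0\rangle,\qquad \langle\widehat\mu|=\alpha_{\widehat\mu}(-1)^{r+|\widehat\mu|}\langle0|\phi_{-m_{2r}}\cdots\phi_{-m_1}.$$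 Write $\widehat\nu\prec\widehat\mu$ ($\widehat\nu$ interlaces $\widehat\mu$) if $\mu_j\ge\nu_j\ge\mu_{j+1}$ for all $j\ge1$, where $\mu_1>\mu_2>\cdots$ and $\nu_1>\nu_2>\cdots$ are the nonzero parts, continued by zeros. Let $n(\widehat\nu|\widehat\mu)$ be the number of nonzero parts of $\widehat\nu$ that are not parts of $\widehat\mu$. **Lemma 2.** For all strict partitions $\widehat\mu,\widehat\nu$, as formal series in $z$, $$\langle\widehat\nu|\widehat\Gamma_+(z)|\widehat\mu\rangle=\begin{cases}2^{n(\widehat\nu|\widehat\mu)}\,z^{|\widehat\nu|-|\widehat\mu|},&\widehat\nu\prec\widehat\mu\text{ and }n(\widehat\nu)=n(\widehat\mu),\\(-1)^{n(\widehat\mu)}\,2^{n(\widehat\nu|\widehat\mu)+\frac12}\,z^{|\widehat\nu|-|\widehat\mu|},&\widehat\nu\prec\widehat\mu\text{ and }n(\widehat\nu)=n(\widehat\mu)-1,\\0,&\text{otherwise,}\end{cases}$$ $$\langle\widehat\mu|\widehat\Gamma_-(z)|\widehat\nu\rangle=\begin{cases}2^{n(\widehat\nu|\widehat\mu)}\,z^{|\widehat\mu|-|\widehat\nu|},&\widehat\nu\prec\widehat\mu\text{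 and }n(\widehat\nu)=n(\widehat\mu),\\(-1)^{n(\widehat\mu)}\,2^{n(\widehat\nu|\widehat\mu)+\frac12}\,z^{|\widehat\mu|-|\widehat\nu|},&\widehat\nu\prec\widehat\mu\text{ and }n(\widehat\nu)=n(\widehat\mu)-1,\\0,&\text{otherwise.}\end{cases}$$ -/

import Mathlib

/-!
Neutral fermions on half-line Maya diagrams, the neutral fermion vertex operators as formal
series in an indeterminate `z`, and strict partitions.
-/

noncomputable section

namespace NeutralFermion

/-- A half-line Maya diagram of finite energy. The sites are `0, 1, 2, …`; the finite set records
the sites that carry a white stone, all remaining sites carry a black stone. (The sites to the left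
of the origin are frozen to be white and carry no information.) -/
abbrev Maya : Type := Finset ℕ

/-- The neutral fermion Fock space: the complex vector space with basis the half-line Maya
diagrams of finite energy. -/
abbrev Fock : Type := Maya →₀ ℂ

/-- The state vector of a Maya diagram. -/
def state (S : Maya) : Fock := Finsupp.single S 1

/-- The initial vacuum `|0⟩`: black stones on the origin and on all positive sites. -/
def vacuum : Fock := state ∅

/-- The final vacuum `⟨0|`, as a linear functional on the Fock space. -/
def coVacuum : Fock →ₗ[ℂ] ℂ := Finsupp.lapply ∅

/-- The number of black stones strictly to the left of the site `n`. -/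
def blackBelow (S : Maya) (n : ℕ) : ℕ := ((Finset.range n).filter (fun j => j ∉ S)).card

/-- The action of the neutral fermion `φ_m` on the state of a Maya diagram. For `m > 0` it puts a
white stone on the site `m`, if there is a black stone; for `m < 0` it puts a black stone on the
site `-m`, if there is a white stone; for `m = 0` it changes the stone at the origin. -/
def phiState (m : ℤ) (S : Maya) : Fock :=
  if 0 < m then
    if m.natAbs ∈ S then 0
    else (-1 : ℂ) ^ (m.natAbs + blackBelow S m.natAbs) • state (insert m.natAbs S)
  else if m < 0 then
    if m.natAbs ∈ S then
      (-1 : ℂ) ^ blackBelow S m.natAbs • state (S.erase m.natAbs)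
    else 0
  else
    ((Real.sqrt 2 : ℝ) : ℂ)⁻¹ • (if 0 ∈ S then state (S.erase 0) else state (insert 0 S))

/-- The neutral fermion `φ_m`, `m ∈ ℤ`, as an operator on the Fock space. -/
def phi (m : ℤ) : Module.End ℂ Fock := Finsupp.linearCombination ℂ (phiState m)

theorem phi_state (m : ℤ) (S : Maya) : phi m (state S) = phiState m S := by
  simp [phi, state]

/-- The Heisenberg operator `λ_m = ½ ∑_{j ∈ ℤ} (-1)^(j+1) φ_j φ_{-j-m}`, for odd `m`.
On each basis state only finitely many terms of the sum are nonzero. -/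
def lambda (m : ℤ) : Module.End ℂ Fock :=
  Finsupp.linearCombination ℂ (fun S : Maya =>
    (1 / 2 : ℂ) • ∑ᶠ j : ℤ, (-1 : ℂ) ^ (j + 1) • phi j (phi (-j - m) (state S)))

/-- The sum in the definition of `λ_m` is finite on each basis state, for every `m ≠ 0`. -/
theorem lambda_support_finite {m : ℤ} (hm : m ≠ 0) (S : Maya) :
    (Function.support
      (fun j : ℤ => (-1 : ℂ) ^ (j + 1) • phi j (phi (-j - m) (state S)))).Finite := by
  obtain ⟨B, hB⟩ : ∃ B : ℕ, ∀ n ∈ S, n < B :=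
    ⟨S.sup id + 1, fun n hn => Nat.lt_succ_of_le (Finset.le_sup (f := id) hn)⟩
  apply (Set.finite_Icc (-(B + m.natAbs : ℤ)) (B + m.natAbs : ℤ)).subset
  intro j hj
  by_contra hout
  apply hj
  have hzero : phi j (phi (-j - m) (state S)) = 0 := by
    rw [phi_state]
    rcases lt_or_ge 0 j with h | h
    · have h1 : ¬ (0 < -j - m) := by simp only [Set.mem_Icc] at hout; omega
      have h2 : -j - m < 0 := by simp only [Set.mem_Icc] at hout; omega
      have h3 : (-j - m).natAbs ∉ S := fun hS => by
        have := hB _ hS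
        simp only [Set.mem_Icc] at hout; omega
      have h4 : phiState (-j - m) S = 0 := by
        unfold phiState
        rw [if_neg h1, if_pos h2, if_neg h3]
      rw [h4, map_zero]
    · have h1 : 0 < -j - m := by simp only [Set.mem_Icc] at hout; omega
      have h2 : j < 0 := by simp only [Set.mem_Icc] at hout; omega
      have h3 : j.natAbs ∉ S := fun hS => by
        have := hB _ hS
        simp only [Set.mem_Icc] at hout; omega
      have h4 : j.natAbs ≠ (-j - m).natAbs := by omega
      have h5 : phiState j (insert (-j - m).natAbs S) = 0 := by
        have h6 : j.natAbs ∉ insert (-j - m).natAbs S := by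
          simp only [Finset.mem_insert, not_or]
          exact ⟨h4, h3⟩
        unfold phiState
        rw [if_neg (not_lt.mpr h), if_pos h2, if_neg h6]
      unfold phiState
      rw [if_pos h1]
      split_ifs
      · exact map_zero _
      · rw [map_smul, phi_state, h5, smul_zero]
  simp only [hzero, smul_zero]

/-- The exponential `∑_k A^k / k!` of a formal power series `A` with zero constant term, over a
possibly noncommutative `ℂ`-algebra. As `A` has zero constant term, only the terms `k ≤ n`
contribute to the coefficient of degree `n`. -/
def expSeries {E : Type*} [Ring E] [Algebra ℂ E] (A : PowerSeries E) : PowerSeries E :=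
  PowerSeries.mk fun n =>
    ∑ k ∈ Finset.range (n + 1), ((k.factorial : ℂ)⁻¹) • PowerSeries.coeff n (A ^ k)

/-- `∑_{m > 0 odd} (2/m) λ_{s m} w^m`, a formal power series in `w` with operator coefficients. -/
def evolution (s : ℤ) : PowerSeries (Module.End ℂ Fock) :=
  PowerSeries.mk fun m => if Odd m then (2 / (m : ℂ)) • lambda (s * m) else 0

/-- The vertex operator `Γ̂₊(z) = exp (∑_{m > 0 odd} (2/m) z^(-m) λ_m)`, a formal series in `z`:
`gammaPlus k` is the coefficient of `z^k`. It is a power series in `z^(-1)`. -/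
def gammaPlus (k : ℤ) : Module.End ℂ Fock :=
  if k ≤ 0 then PowerSeries.coeff k.natAbs (expSeries (evolution 1)) else 0

/-- The vertex operator `Γ̂₋(z) = exp (∑_{m > 0 odd} (2/m) z^m λ_{-m})`, a formal series in `z`:
`gammaMinus k` is the coefficient of `z^k`. It is a power series in `z`. -/
def gammaMinus (k : ℤ) : Module.End ℂ Fock :=
  if 0 ≤ k then PowerSeries.coeff k.natAbs (expSeries (evolution (-1))) else 0

/-- The matrix element `⟨f| G(z) |v⟩` of a formal series `G(z) = ∑_k G_k z^k` of operators: the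
formal series in `z` with the coefficients `⟨f| G_k |v⟩`. -/
def matrixElement (f : Fock →ₗ[ℂ] ℂ) (G : ℤ → Module.End ℂ Fock) (v : Fock) : ℤ → ℂ :=
  fun k => f (G k v)

/-- The formal series `c z^k`. -/
def monomial (k : ℤ) (c : ℂ) : ℤ → ℂ := Pi.single k c

/-- A strict partition, given by the finite set of its nonzero parts. -/
structure StrictPartition where
  /-- the nonzero parts -/
  parts : Finset ℕ
  pos : ∀ m ∈ parts, 0 < m

namespace StrictPartition

/-- The number `n(μ)` of nonzero parts. -/
def length (μ : StrictPartition) : ℕ := μ.parts.card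

/-- The size `|μ|`. -/
def size (μ : StrictPartition) : ℕ := ∑ m ∈ μ.parts, m

/-- The number `n(ν|μ)` of nonzero parts of `ν` that are not parts of `μ`. -/
def newParts (ν μ : StrictPartition) : ℕ := (ν.parts \ μ.parts).card

/-- The `(j+1)`-st largest part (the index `j` starts from `0`); zero beyond the last nonzero
part. -/
def part (μ : StrictPartition) (j : ℕ) : ℕ := (μ.parts.sort (· ≥ ·)).getD j 0

/-- `ν ≺ μ`: the partition `ν` interlaces `μ`, that is,
`μ₁ ≥ ν₁ ≥ μ₂ ≥ ν₂ ≥ μ₃ ≥ …`. -/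
def Interlaces (ν μ : StrictPartition) : Prop := ∀ j : ℕ, ν.part j ≤ μ.part j ∧ μ.part (j + 1) ≤ ν.part j

/-- The set `{m_1 > … > m_{2r} ≥ 0}` of an even number of labels: the nonzero parts, together with
one zero part if the number of nonzero parts is odd. -/
def labels (μ : StrictPartition) : Finset ℕ := if Even μ.parts.card then μ.parts else insert 0 μ.parts

/-- Half of the number of labels. -/
def r (μ : StrictPartition) : ℕ := μ.labels.card / 2

/-- `α = √2` if the smallest label `m_{2r}` is zero, and `α = 1` otherwise. -/
def alpha (μ : StrictPartition) : ℂ := if 0 ∈ μ.labels then ((Real.sqrt 2 : ℝ) : ℂ) else 1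

/-- The initial state `|μ⟩ = α (-1)^r φ_{m_1} ⋯ φ_{m_{2r}} |0⟩`. -/
def ket (μ : StrictPartition) : Fock :=
  (μ.alpha * (-1) ^ μ.r) •
    ((μ.labels.sort (· ≥ ·)).map (fun m : ℕ => phi (m : ℤ))).prod vacuum

/-- The final state `⟨μ| = α (-1)^(r+|μ|) ⟨0| φ_{-m_{2r}} ⋯ φ_{-m_1}`. -/
def bra (μ : StrictPartition) : Fock →ₗ[ℂ] ℂ :=
  (μ.alpha * (-1) ^ (μ.r + μ.size)) •
    (coVacuum ∘ₗ ((μ.labels.sort (· ≤ ·)).map (fun m : ℕ => phi (-(m : ℤ)))).prod)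

end StrictPartition

end NeutralFermion

end

/-!
The proof is the free-fermion argument in its most economical form.

The neutral fermions satisfy the Clifford relations (`phi_anticomm`), so `[λ_m, φ_n] = φ_{n-m}` for
odd `m` (`lambda_phi`). Hence conjugation by `Γ̂₊(z)` replaces `φ_n` by `∑_k q_k z^{-k} φ_{n-k}`,
where `∑_k q_k X^k = exp (∑_{m odd} (2/m) X^m) = (1 + X) / (1 - X)`. Clearing the denominator leaves
the two-term relation `Γ̂₊(z) (φ_n - z⁻¹ φ_{n-1}) = (φ_n + z⁻¹ φ_{n-1}) Γ̂₊(z)` (`gammaPlus_phi`).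
It takes the place of Wick's theorem: together with the fact that `Γ̂₊(z)` fixes the vacuum
(`gammaPlus_vac`), it is a recursion for the matrix elements that lowers the largest label of the
initial state by one or removes it, and it produces the weights `1` and `2` of the parts of `ν̂` one
at a time (`pairing_gammaPlus_ketList`).

The zero label is absorbed into the vacuum: `√2 φ_0 |0⟩` is again a basis state annihilated by
all `φ_{-n}`, `n > 0`, and fixed by `Γ̂₊(z)`. The products of the nonzero labels are therefore
applied to either of two vacua, according to the parity of the number of parts. The recursion meets
`φ_0` only when it removes the label `1`, where `φ_0` exchanges the two vacua; this is the source
of the factor `√2` when `ν̂` has one part less than `μ̂`.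

Finally, in the bilinear form that makes the states of the Maya diagrams orthonormal, the transpose
of `φ_m` is `(-1)^m φ_{-m}`, so that the transpose of `λ_m` is `λ_{-m}`, that of `Γ̂₊(z⁻¹)` is
`Γ̂₋(z)` (`pairing_gammaPlus`), and that of `|μ̂⟩` is `⟨μ̂|` (`StrictPartition.bra_eq`). The formula
for `Γ̂₋` is thus the one for `Γ̂₊` with `z` replaced by `z⁻¹`.
-/

noncomputable section

namespace NeutralFermion

open Finset

/-! ### The Clifford relations -/

/-- The Maya diagram with the stone at the site `n` exchanged. -/
def flip (S : Maya) (n : ℕ) : Maya := if n ∈ S then S.erase n else insert n S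

/-- The sign `(-1)^k`, where `k` is the number of black stones to the left of the site `n`. -/
def stringSign (S : Maya) (n : ℕ) : ℂ := (-1) ^ blackBelow S n

/-- The coefficient of `φ_m` that is left after the flip of the site `|m|` and the sign of the
stones to its left are taken out; `w` tells whether the site is white. -/
def flipCoeff (m : ℤ) (w : Prop) [Decidable w] : ℂ :=
  if 0 < m then if w then 0 else (-1) ^ m
  else if m < 0 then if w then 1 else 0
  else ((Real.sqrt 2 : ℝ) : ℂ)⁻¹

theorem mem_flip {S : Maya} {i n : ℕ} : i ∈ flip S n ↔ (if i = n then n ∉ S else i ∈ S) := by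
  unfold flip; split_ifs with h1 h2 h2 <;> simp [h1, h2]

theorem flip_flip (S : Maya) (n : ℕ) : flip (flip S n) n = S := by
  ext i
  by_cases h : i = n
  · subst h; simp [mem_flip]
  · simp [mem_flip, h]

theorem flip_comm (S : Maya) (m n : ℕ) : flip (flip S m) n = flip (flip S n) m := by
  by_cases h : m = n
  · rw [h]
  · ext i
    by_cases h1 : i = m
    · subst h1; simp [mem_flip, h]
    · by_cases h2 : i = n
      · subst h2; simp [mem_flip, h1]
      · simp [mem_flip, h1, h2]

theorem stringSign_mul_self (S : Maya) (n : ℕ) : stringSign S n * stringSign S n = 1 := by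
  unfold stringSign; rw [← mul_pow]; simp

theorem stringSign_flip_of_le (S : Maya) {i n : ℕ} (h : n ≤ i) :
    stringSign (flip S i) n = stringSign S n := by
  unfold stringSign blackBelow
  congr 2
  apply filter_congr
  intro j hj
  rw [mem_flip, if_neg (by simp at hj; omega)]

theorem stringSign_insert (S : Maya) {i n : ℕ} (h : i < n) (hi : i ∉ S) :
    stringSign (insert i S) n = -stringSign S n := by
  unfold stringSign blackBelow
  have : (range n).filter (fun j => j ∉ S)
      = insert i ((range n).filter (fun j => j ∉ insert i S)) := by
    ext j; simp only [mem_filter, mem_range, mem_insert]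
    by_cases hj : j = i
    · subst hj; simp [h, hi]
    · simp [hj]
  rw [this, card_insert_of_notMem (by simp), pow_succ]
  ring

theorem stringSign_flip_of_lt (S : Maya) {i n : ℕ} (h : i < n) :
    stringSign (flip S i) n = -stringSign S n := by
  unfold flip
  split_ifs with hi
  · have := stringSign_insert (S.erase i) h (by simp)
    rw [insert_erase hi] at this
    rw [this, neg_neg]
  · exact stringSign_insert S h hi

/-- All neutral fermions act by flipping one stone, up to a scalar: this form treats the three
signs of `m` uniformly. -/
theorem phi_state_eq_flip (m : ℤ) (S : Maya) :
    phi m (state S) = (flipCoeff m (m.natAbs ∈ S) * stringSign S m.natAbs) •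
      state (flip S m.natAbs) := by
  rw [phi_state]
  unfold phiState flipCoeff stringSign flip
  rcases lt_trichotomy m 0 with h | rfl | h
  · simp only [not_lt.mpr h.le, h, if_true, if_false]
    split_ifs <;> simp
  · simp [blackBelow]
    split_ifs <;> rfl
  · rw [if_pos h, if_pos h]
    split_ifs
    · simp
    · obtain ⟨k, rfl⟩ := Int.eq_ofNat_of_zero_le h.le
      simp [pow_add]

theorem end_ext {A B : Module.End ℂ Fock} (h : ∀ S, A (state S) = B (state S)) : A = B := by
  apply Finsupp.lhom_ext'
  intro S
  apply LinearMap.ext_ring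
  exact h S

theorem sqrt_two_inv_mul_self :
    ((Real.sqrt 2 : ℝ) : ℂ)⁻¹ * ((Real.sqrt 2 : ℝ) : ℂ)⁻¹ = 1 / 2 := by
  rw [← mul_inv, ← Complex.ofReal_mul, Real.mul_self_sqrt (by norm_num)]
  norm_num

theorem neg_one_zpow_neg (m : ℤ) : (-1 : ℂ) ^ (-m) = (-1) ^ m := by
  rw [zpow_neg, ← inv_zpow]; norm_num

theorem neg_one_zpow_mul_self (m : ℤ) : (-1 : ℂ) ^ m * (-1) ^ m = 1 := by
  rw [← mul_zpow]; simp

theorem phi_phi_state (m n : ℤ) (S : Maya) :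
    phi m (phi n (state S)) =
      (flipCoeff n (n.natAbs ∈ S) * stringSign S n.natAbs *
        (flipCoeff m (m.natAbs ∈ flip S n.natAbs) * stringSign (flip S n.natAbs) m.natAbs)) •
      state (flip (flip S n.natAbs) m.natAbs) := by
  rw [phi_state_eq_flip, map_smul, phi_state_eq_flip, smul_smul]

/-- The Clifford relations. For `|m| ≠ |n|` the two flips commute, and exactly one of the two signs
`stringSign` changes with the order in which they are carried out. -/
theorem phi_anticomm (m n : ℤ) :
    phi m * phi n + phi n * phi m = if m + n = 0 then ((-1 : ℂ) ^ m) • 1 else 0 := by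
  apply end_ext
  intro S
  rw [LinearMap.add_apply, Module.End.mul_apply, Module.End.mul_apply,
    phi_phi_state, phi_phi_state]
  by_cases hmn : m.natAbs = n.natAbs
  · rw [← hmn, flip_flip, stringSign_flip_of_le _ le_rfl, ← add_smul]
    have hs := stringSign_mul_self S m.natAbs
    have key : flipCoeff n (m.natAbs ∈ S) * flipCoeff m (m.natAbs ∈ flip S m.natAbs)
        + flipCoeff m (m.natAbs ∈ S) * flipCoeff n (m.natAbs ∈ flip S m.natAbs)
        = if m + n = 0 then (-1 : ℂ) ^ m else 0 := by
      have hf : (m.natAbs ∈ flip S m.natAbs) ↔ m.natAbs ∉ S := by simp [mem_flip]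
      simp only [hf]
      rcases Int.natAbs_eq_natAbs_iff.mp hmn with rfl | rfl
      · rcases lt_trichotomy m 0 with h | rfl | h
        · rw [if_neg (by omega)]; unfold flipCoeff
          split_ifs <;> first | omega | simp_all
        · simp [flipCoeff, sqrt_two_inv_mul_self]
          norm_num
        · rw [if_neg (by omega)]; unfold flipCoeff
          split_ifs <;> first | omega | simp_all
      · rw [if_pos (by omega)]
        rcases lt_trichotomy n 0 with h | rfl | h
        · unfold flipCoeff; simp only [neg_one_zpow_neg]
          split_ifs <;> first | omega | simp_all
        · simp [flipCoeff, sqrt_two_inv_mul_self]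
          norm_num
        · unfold flipCoeff; simp only [neg_one_zpow_neg]
          split_ifs <;> first | omega | simp_all
    have : (if m + n = 0 then ((-1 : ℂ) ^ m) • (1 : Module.End ℂ Fock) else 0) (state S)
        = (if m + n = 0 then (-1 : ℂ) ^ m else 0) • state S := by split_ifs <;> simp
    rw [this, ← key]
    congr 1
    linear_combination (flipCoeff n (m.natAbs ∈ S) * flipCoeff m (m.natAbs ∈ flip S m.natAbs)
        + flipCoeff m (m.natAbs ∈ S) * flipCoeff n (m.natAbs ∈ flip S m.natAbs)) * hs
  · rw [if_neg (by omega), flip_comm S m.natAbs, ← add_smul]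
    have h1 : (m.natAbs ∈ flip S n.natAbs) ↔ m.natAbs ∈ S := by simp [mem_flip, hmn]
    have h2 : (n.natAbs ∈ flip S m.natAbs) ↔ n.natAbs ∈ S := by
      simp [mem_flip, Ne.symm hmn]
    simp only [h1, h2]
    have : stringSign S n.natAbs * stringSign (flip S n.natAbs) m.natAbs =
        - (stringSign S m.natAbs * stringSign (flip S m.natAbs) n.natAbs) := by
      rcases lt_or_gt_of_ne hmn with h | h
      · rw [stringSign_flip_of_le S h.le, stringSign_flip_of_lt S h]; ring
      · rw [stringSign_flip_of_le S h.le, stringSign_flip_of_lt S h]; ring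
    rw [LinearMap.zero_apply]
    convert zero_smul ℂ _
    linear_combination (flipCoeff n (n.natAbs ∈ S) * flipCoeff m (m.natAbs ∈ S)) * this

theorem phi_phi_apply (m n : ℤ) (x : Fock) :
    phi m (phi n x) = (if m + n = 0 then (-1 : ℂ) ^ m else 0) • x - phi n (phi m x) := by
  have := congrArg (fun A : Module.End ℂ Fock => A x) (phi_anticomm m n)
  simp only [LinearMap.add_apply, Module.End.mul_apply] at this
  rw [eq_sub_iff_add_eq, this]
  split_ifs <;> simp

theorem phi_phi_of_ne {m n : ℤ} (h : m + n ≠ 0) (x : Fock) :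
    phi m (phi n x) = - phi n (phi m x) := by
  rw [phi_phi_apply, if_neg h, zero_smul, zero_sub]

theorem phi_phi_self {m : ℤ} (h : m ≠ 0) (x : Fock) : phi m (phi m x) = 0 := by
  have := phi_phi_of_ne (m := m) (n := m) (by omega) x
  exact self_eq_neg.mp this

/-! ### The bilinear form with orthonormal states -/

/-- The symmetric bilinear form on the Fock space for which the states of the Maya diagrams are
orthonormal. -/
def pairing : Fock →ₗ[ℂ] Fock →ₗ[ℂ] ℂ :=
  Finsupp.linearCombination ℂ (fun S : Maya => Finsupp.lapply S)

theorem pairing_state (S T : Maya) : pairing (state S) (state T) = if S = T then 1 else 0 := by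
  simp [pairing, state, Finsupp.single_apply, eq_comm]

theorem pairing_vacuum : pairing vacuum = coVacuum := by
  simp [pairing, vacuum, state, coVacuum]

theorem bilin_ext {B C : Fock →ₗ[ℂ] Fock →ₗ[ℂ] ℂ}
    (h : ∀ S T, B (state S) (state T) = C (state S) (state T)) : B = C := by
  apply Finsupp.lhom_ext'
  intro S
  apply LinearMap.ext_ring
  apply Finsupp.lhom_ext'
  intro T
  apply LinearMap.ext_ring
  exact h S T

theorem pairing_comm (x y : Fock) : pairing x y = pairing y x := by
  have : pairing = pairing.flip := bilin_ext fun S T => by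
    simp [pairing_state, eq_comm]
  conv_lhs => rw [this]
  rfl

/-- The transpose of `φ_m` is `(-1)^m φ_{-m}`. -/
theorem pairing_phi_left (m : ℤ) (x y : Fock) :
    pairing (phi m x) y = (-1) ^ m * pairing x (phi (-m) y) := by
  have : pairing.comp (phi m) = ((-1 : ℂ) ^ m) • pairing.compl₂ (phi (-m)) := by
    apply bilin_ext
    intro S T
    simp only [LinearMap.comp_apply, LinearMap.smul_apply, LinearMap.compl₂_apply,
      phi_state_eq_flip, map_smul, pairing_state, Int.natAbs_neg, smul_eq_mul]
    by_cases h : flip S m.natAbs = T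
    · subst h
      rw [flip_flip, if_pos rfl, if_pos rfl, stringSign_flip_of_le _ le_rfl]
      have hf : (m.natAbs ∈ flip S m.natAbs) ↔ m.natAbs ∉ S := by simp [mem_flip]
      have hd : flipCoeff m (m.natAbs ∈ S) =
          (-1) ^ m * flipCoeff (-m) (m.natAbs ∈ flip S m.natAbs) := by
        simp only [hf]
        have := neg_one_zpow_mul_self m
        rcases lt_trichotomy m 0 with h | rfl | h
        · unfold flipCoeff; simp only [neg_one_zpow_neg]
          split_ifs <;> first | omega | simp_all
        · simp [flipCoeff]
        · unfold flipCoeff; simp only [neg_one_zpow_neg]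
          split_ifs <;> first | omega | simp_all
      rw [hd]; ring
    · rw [if_neg h, if_neg (fun h' => h (by rw [h', flip_flip]))]
      simp
  exact congrArg (fun B : Fock →ₗ[ℂ] Fock →ₗ[ℂ] ℂ => B x y) this

theorem pairing_phi_right (m : ℤ) (x y : Fock) :
    pairing x (phi m y) = (-1) ^ m * pairing (phi (-m) x) y := by
  rw [pairing_comm, pairing_phi_left, pairing_comm]

end NeutralFermion

namespace NeutralFermion

open Finset Filter

/-! ### The Heisenberg operators -/

/-- One term `(-1)^(j+1) φ_j φ_{-j-m}` of the sum in the definition of `λ_m`. -/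
def lambdaTerm (m j : ℤ) : Module.End ℂ Fock := (-1 : ℂ) ^ (j + 1) • (phi j * phi (-j - m))

/-- On each vector, `λ_m` is given by all sufficiently large finite partial sums. -/
theorem lambda_eventually {m : ℤ} (hm : m ≠ 0) (x : Fock) :
    ∀ᶠ s : Finset ℤ in atTop, lambda m x = (1 / 2 : ℂ) • ∑ j ∈ s, lambdaTerm m j x := by
  induction x using Finsupp.induction_linear with
  | zero => simp
  | add x y hx hy =>
    filter_upwards [hx, hy] with s h1 h2
    simp only [map_add, h1, h2, sum_add_distrib, smul_add]
  | single S c =>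
    filter_upwards [eventually_ge_atTop (lambda_support_finite hm S).toFinset] with s hs
    have h1 : (Finsupp.single S c : Fock) = c • state S := by simp [state]
    have h2 : lambda m (state S) = (1 / 2 : ℂ) • ∑ j ∈ s, lambdaTerm m j (state S) := by
      have : lambda m (state S) = (1 / 2 : ℂ) • ∑ᶠ j : ℤ, (-1 : ℂ) ^ (j + 1) •
          phi j (phi (-j - m) (state S)) := by simp [lambda, state]
      rw [this, finsum_eq_sum_of_support_subset _ (s := s)]
      · rfl
      · intro j hj
        exact hs (by simpa using hj)
    simp only [h1, map_smul, h2, ← smul_sum]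
    exact smul_comm _ _ _

/-- Only the terms of index `n - m` and `-n` of `λ_m` fail to commute with `φ_n`. -/
theorem lambdaTerm_commutator (m j n : ℤ) (x : Fock) :
    lambdaTerm m j (phi n x) - phi n (lambdaTerm m j x) =
      (if j = n - m then (-1 : ℂ) ^ (m + 1) • phi (n - m) x else 0) +
        if j = -n then phi (n - m) x else 0 := by
  have e1 : phi (-j - m) (phi n x) = _ := phi_phi_apply (-j - m) n x
  have e2 : phi j (phi n (phi (-j - m) x)) = _ := phi_phi_apply j n _
  simp only [lambdaTerm, LinearMap.smul_apply, Module.End.mul_apply, map_smul]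
  rw [e1, map_sub, map_smul, e2, ← smul_sub]
  have h1 : (-j - m + n = 0) ↔ j = n - m := by omega
  have h2 : (j + n = 0) ↔ j = -n := by omega
  simp only [h1, h2]
  have z : ∀ k : ℤ, (-1 : ℂ) ^ (k + 1) * (-1) ^ k = -1 := fun k => by
    rw [zpow_add_one₀ (by norm_num)]
    linear_combination -neg_one_zpow_mul_self k
  have t1 : j = n - m → (-1 : ℂ) ^ (j + 1) * (-1) ^ (-j - m) = (-1) ^ (m + 1) := by
    intro _
    rw [← zpow_add₀ (by norm_num), show j + 1 + (-j - m) = -(m + 1) + 2 by ring,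
      zpow_add₀ (by norm_num), neg_one_zpow_neg]
    norm_num
  split_ifs with a b b
  · have hm : m = 2 * n := by omega
    subst a
    rw [smul_sub, smul_sub, smul_smul, t1 rfl, smul_sub, smul_smul, z, hm,
      show -(n - 2 * n) - 2 * n = n - 2 * n by ring]
    module
  · subst a
    rw [smul_sub, smul_sub, smul_smul, t1 rfl]
    module
  · subst b
    rw [smul_sub, smul_sub, smul_sub, smul_smul _ _ (phi (- -n - m) x), z,
      show - -n - m = n - m by ring]
    module
  · module

theorem lambda_phi {m : ℤ} (hm : Odd m) (n : ℤ) (x : Fock) :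
    lambda m (phi n x) = phi (n - m) x + phi n (lambda m x) := by
  have hm0 : m ≠ 0 := by rintro rfl; simp at hm
  obtain ⟨s, h1, h2, h3⟩ := ((lambda_eventually hm0 (phi n x)).and
    ((lambda_eventually hm0 x).and (eventually_ge_atTop {n - m, -n}))).exists
  rw [← sub_eq_iff_eq_add, h1, h2, map_smul, map_sum, ← smul_sub, ← sum_sub_distrib]
  simp only [lambdaTerm_commutator, sum_add_distrib, sum_ite_eq']
  rw [if_pos (h3 (by simp)), if_pos (h3 (by simp)), hm.add_one.neg_one_zpow, one_smul,
    ← two_smul ℂ, smul_smul]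
  norm_num

theorem pairing_lambda {m : ℤ} (hm : Odd m) (x y : Fock) :
    pairing (lambda m x) y = pairing x (lambda (-m) y) := by
  have hm0 : m ≠ 0 := by rintro rfl; simp at hm
  obtain ⟨s₁, h1⟩ := eventually_atTop.mp (lambda_eventually hm0 x)
  obtain ⟨s₂, h2⟩ := eventually_atTop.mp (lambda_eventually (neg_ne_zero.mpr hm0) y)
  -- the term of index `j` of `λ_m` is the transpose of the term of index `j + m` of `λ_{-m}`
  have ht : ∀ j, pairing (lambdaTerm m j x) y = pairing x (lambdaTerm (-m) (j + m) y) := by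
    intro j
    simp only [lambdaTerm, LinearMap.smul_apply, Module.End.mul_apply, map_smul,
      pairing_phi_left, smul_eq_mul, show -(j + m) - -m = -j by ring,
      show -(-j - m) = j + m by ring]
    rw [← mul_assoc, ← mul_assoc, ← zpow_add₀ (by norm_num), ← zpow_add₀ (by norm_num)]
    congr 1
    rw [show j + 1 + j + (-j - m) = (j + m + 1) + (-2 * m) by ring, zpow_add₀ (by norm_num)]
    rw [zpow_mul]; norm_num
  let e := (Equiv.addRight m).toEmbedding
  set s := s₁ ∪ s₂.map (Equiv.addRight (-m)).toEmbedding
  have hs : s₂ ≤ s.map e := by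
    intro j hj
    simp only [Finset.mem_map, s, mem_union, e]
    exact ⟨j - m, Or.inr ⟨j, hj, by simp [sub_eq_add_neg]⟩, by simp⟩
  rw [h1 s subset_union_left, h2 _ hs]
  simp only [map_smul, map_sum, LinearMap.smul_apply, LinearMap.sum_apply, sum_map, ht]
  rfl

/-- The two states annihilated by all `φ_{-n}` with `n > 0`: the vacuum and `√2 φ_0 |0⟩`. -/
def vac (b : Bool) : Fock := state (if b then {0} else ∅)

theorem phi_neg_vac {m : ℤ} (hm : m < 0) (b : Bool) : phi m (vac b) = 0 := by
  rw [vac, phi_state, phiState, if_neg (by omega), if_pos hm, if_neg]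
  cases b <;> simp; omega

theorem phi_zero_vac (b : Bool) : phi 0 (vac b) = ((Real.sqrt 2 : ℝ) : ℂ)⁻¹ • vac (!b) := by
  cases b <;> simp [vac, phi_state, phiState]

theorem pairing_vac (b c : Bool) : pairing (vac b) (vac c) = if b = c then 1 else 0 := by
  cases b <;> cases c <;> simp [vac, pairing_state, eq_comm]

theorem lambda_vac {m : ℤ} (hm : 0 < m) (b : Bool) : lambda m (vac b) = 0 := by
  obtain ⟨s, h⟩ := (lambda_eventually hm.ne' (vac b)).exists
  rw [h, sum_eq_zero, smul_zero]
  intro j _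
  simp only [lambdaTerm, LinearMap.smul_apply, Module.End.mul_apply]
  rcases lt_or_ge j 0 with hj | hj
  · rw [phi_phi_of_ne (by omega), phi_neg_vac hj, map_zero, neg_zero, smul_zero]
  · rw [phi_neg_vac (m := -j - m) (by omega), map_zero, smul_zero]

end NeutralFermion

namespace NeutralFermion

open Finset PowerSeries

/-! ### Exponentials of formal power series -/

section ExpSeries

variable {E : Type*} [Ring E]

theorem coeff_pow_of_lt {A : PowerSeries E} (hA : coeff 0 A = 0) {n k : ℕ} (h : n < k) :
    coeff n (A ^ k) = 0 := by
  obtain ⟨B, rfl⟩ := X_dvd_iff.mpr (by simpa using hA)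
  rw [(commute_X B).symm.mul_pow]
  exact X_pow_dvd_iff.mp (Dvd.intro _ rfl) n h

variable [Algebra ℂ E]

theorem coeff_expSeries {A : PowerSeries E} (hA : coeff 0 A = 0) {n M : ℕ} (h : n ≤ M) :
    coeff n (expSeries A) =
      ∑ k ∈ range (M + 1), ((k.factorial : ℂ)⁻¹) • coeff n (A ^ k) := by
  rw [expSeries, coeff_mk]
  apply sum_subset (range_subset_range.mpr (by omega))
  intro k _ hk
  rw [coeff_pow_of_lt hA (by simpa using hk), smul_zero]

theorem coeff_expSeries_mul {A : PowerSeries E} (hA : coeff 0 A = 0) (Y : PowerSeries E)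
    {n M : ℕ} (h : n ≤ M) : coeff n (expSeries A * Y) =
      ∑ k ∈ range (M + 1), ((k.factorial : ℂ)⁻¹) • coeff n (A ^ k * Y) := by
  simp only [coeff_mul, smul_sum]
  rw [sum_comm]
  apply sum_congr rfl
  intro p hp
  rw [coeff_expSeries hA (M := M) (by have := HasAntidiagonal.mem_antidiagonal.mp hp; omega),
    sum_mul]
  simp only [smul_mul_assoc]

theorem coeff_mul_expSeries {A : PowerSeries E} (hA : coeff 0 A = 0) (Y : PowerSeries E)
    {n M : ℕ} (h : n ≤ M) : coeff n (Y * expSeries A) =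
      ∑ k ∈ range (M + 1), ((k.factorial : ℂ)⁻¹) • coeff n (Y * A ^ k) := by
  simp only [coeff_mul, smul_sum]
  rw [sum_comm]
  apply sum_congr rfl
  intro p hp
  rw [coeff_expSeries hA (M := M) (by have := HasAntidiagonal.mem_antidiagonal.mp hp; omega),
    mul_sum]
  simp only [mul_smul_comm]

end ExpSeries

theorem inv_factorial_mul_choose {k : ℕ} {p : ℕ × ℕ} (hp : p ∈ antidiagonal k) :
    (k.factorial : ℂ)⁻¹ * (k.choose p.1 : ℂ) = (p.1.factorial : ℂ)⁻¹ * (p.2.factorial : ℂ)⁻¹ := by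
  obtain ⟨i, j⟩ := p
  obtain rfl := HasAntidiagonal.mem_antidiagonal.mp hp
  have h := Nat.choose_mul_factorial_mul_factorial (Nat.le_add_right i j)
  rw [Nat.add_sub_cancel_left] at h
  have h' : ((i + j).choose i : ℂ) * i.factorial * j.factorial = (i + j).factorial := by
    exact_mod_cast h
  have h1 : ((i + j).factorial : ℂ) ≠ 0 := by exact_mod_cast Nat.factorial_ne_zero _
  have h2 : (i.factorial : ℂ) ≠ 0 := by exact_mod_cast Nat.factorial_ne_zero _
  have h3 : (j.factorial : ℂ) ≠ 0 := by exact_mod_cast Nat.factorial_ne_zero _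
  field_simp
  linear_combination h'

/-- A sum over a triangle is the sum over a square, if the terms beyond the diagonal vanish. -/
theorem sum_triangle_eq_sum_square {M : Type*} [AddCommMonoid M] (n : ℕ) (f : ℕ → ℕ → M)
    (hf : ∀ i j, n < i + j → f i j = 0) :
    ∑ k ∈ range (n + 1), ∑ p ∈ antidiagonal k, f p.1 p.2 =
      ∑ i ∈ range (n + 1), ∑ j ∈ range (n + 1), f i j := by
  rw [← sum_product' (range (n + 1)) (range (n + 1)) f]
  have h1 : ∑ p ∈ range (n + 1) ×ˢ range (n + 1), f p.1 p.2 =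
      ∑ p ∈ (range (n + 1) ×ˢ range (n + 1)).filter (fun p => p.1 + p.2 ≤ n), f p.1 p.2 := by
    symm
    apply sum_subset (filter_subset _ _)
    intro p hp hp'
    exact hf _ _ (by simp only [mem_filter, hp, true_and] at hp'; omega)
  rw [h1, ← sum_fiberwise_of_maps_to (t := range (n + 1)) (g := fun p : ℕ × ℕ => p.1 + p.2)
    (fun p hp => by simp only [mem_filter, mem_product, mem_range] at hp ⊢; omega)]
  apply sum_congr rfl
  intro k hk
  apply sum_congr _ (fun _ _ => rfl)
  ext p
  simp only [mem_filter, mem_product, mem_range, HasAntidiagonal.mem_antidiagonal] at hk ⊢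
  omega

/-! ### The intertwining relation -/

/-- The exponent `∑_{m > 0 odd} (2/m) X^m`, whose exponential is `(1 + X) / (1 - X)`. -/
def oddLog : PowerSeries ℂ := PowerSeries.mk fun m => if Odd m then 2 / (m : ℂ) else 0

theorem coeff_zero_oddLog : coeff 0 oddLog = 0 := by simp [oddLog]

theorem derivative_oddLog : (1 - X ^ 2) * derivative ℂ oddLog = 2 := by
  have hd : ∀ n, coeff n (derivative ℂ oddLog) = if Even n then 2 else 0 := by
    intro n
    rw [coeff_derivative, oddLog, coeff_mk]
    have : (n + 1 : ℂ) ≠ 0 := by exact_mod_cast Nat.succ_ne_zero n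
    by_cases h : Even n
    · rw [if_pos h, if_pos h.add_one]; push_cast; field_simp
    · rw [if_neg h, if_neg (by rwa [Nat.odd_add_one, Nat.not_odd_iff_even]), zero_mul]
  ext n
  have h2 : (2 : PowerSeries ℂ) = C 2 := (map_ofNat C 2).symm
  rw [sub_mul, one_mul, map_sub, coeff_X_pow_mul', hd, hd, h2, coeff_C]
  rcases n with _ | _ | n
  · simp
  · simp
  · simp [Nat.even_add]

theorem derivative_expSeries {a : PowerSeries ℂ} (ha : coeff 0 a = 0) :
    derivative ℂ (expSeries a) = expSeries a * derivative ℂ a := by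
  ext n
  rw [coeff_derivative, coeff_expSeries_mul ha _ le_rfl, coeff_expSeries ha le_rfl,
    sum_range_succ', add_mul, sum_mul]
  simp only [pow_zero, coeff_one, if_neg (Nat.succ_ne_zero n), smul_zero, zero_mul, add_zero]
  apply sum_congr rfl
  intro k _
  have h1 : coeff (n + 1) (a ^ (k + 1)) * (n + 1) = (k + 1) * coeff n (a ^ k * derivative ℂ a) := by
    rw [← coeff_derivative, Derivation.leibniz_pow, map_nsmul, Nat.add_sub_cancel,
      smul_eq_mul, nsmul_eq_mul]
    push_cast; ring
  have : (k + 1 : ℂ) ≠ 0 := by exact_mod_cast Nat.succ_ne_zero k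
  rw [smul_mul_assoc, h1, Nat.factorial_succ, smul_eq_mul, smul_eq_mul]
  push_cast
  field_simp

/-- The identity `exp (∑_{m odd} (2/m) X^m) = (1 + X) / (1 - X)`, without the denominator. -/
theorem expSeries_oddLog : expSeries oddLog * (1 - X) = 1 + X := by
  set f := expSeries oddLog * (1 - X) with hf
  have h0 : coeff 0 f = 1 := by
    simp [hf, expSeries]
  -- the quotient rule turns the differential equation of `oddLog` into one for `f`
  have hD : (1 + X) * derivative ℂ f = f := by
    have : derivative ℂ f =
        expSeries oddLog * derivative ℂ oddLog * (1 - X) - expSeries oddLog := by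
      rw [hf, Derivation.leibniz, derivative_expSeries coeff_zero_oddLog]
      simp [derivative_X]
      ring
    rw [this, hf]
    linear_combination expSeries oddLog * derivative_oddLog
  have hr : ∀ n, coeff (n + 1) f * (n + 1) + (if n = 0 then 0 else coeff n f * n) = coeff n f := by
    intro n
    conv_rhs => rw [← hD, add_mul, one_mul, map_add, coeff_derivative]
    rcases n with _ | n
    · simp
    · rw [coeff_succ_X_mul, coeff_derivative, if_neg (Nat.succ_ne_zero n)]; push_cast; ring
  have h1 : coeff 1 f = 1 := by simpa [h0] using hr 0
  have h2 : ∀ n, coeff (n + 2) f = 0 := by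
    intro n
    induction n with
    | zero => simpa [h1] using hr 1
    | succ n ih =>
      have := hr (n + 2)
      rw [ih] at this
      simp at this
      rcases this with h | h
      · exact h
      · exfalso
        have : (n + 2 + 1 : ℂ) ≠ 0 := by exact_mod_cast Nat.succ_ne_zero (n + 2)
        exact this h
  ext n
  rcases n with _ | _ | n
  · rw [h0]; simp
  · rw [h1]; simp
  · rw [h2]; simp [coeff_one, coeff_X]

section Intertwining

variable {E : Type*} [Ring E] [Algebra ℂ E]

/-- The series `∑_k g_k X^k φ_{n-k}`, for a scalar series `g = ∑_k g_k X^k` and a family `φ` of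
operators. -/
def phiSeries (φ : ℤ → E) (n : ℤ) (g : PowerSeries ℂ) : PowerSeries E :=
  PowerSeries.mk fun k => coeff k g • φ (n - k)

/-- The hypothesis that `A` acts on the family `φ` by the commutators
`[A, φ_l] = ∑_{i odd} (2/i) X^i φ_{l-i}`. -/
def ShiftsBy (A : PowerSeries E) (φ : ℤ → E) : Prop :=
  ∀ (i : ℕ) (l : ℤ), coeff i A * φ l = coeff i oddLog • φ (l - i) + φ l * coeff i A

variable {A : PowerSeries E} {φ : ℤ → E}

/-- The commutator with `A` acts on the series `phiSeries φ n g` as the multiplication of `g` by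
`oddLog`. -/
theorem ShiftsBy.mul_phiSeries (h : ShiftsBy A φ) (n : ℤ) (g : PowerSeries ℂ) :
    A * phiSeries φ n g = phiSeries φ n (oddLog * g) + phiSeries φ n g * A := by
  ext1 N
  rw [map_add, coeff_mul, coeff_mul, ← Nat.sum_antidiagonal_swap]
  rw [phiSeries, phiSeries, coeff_mk, mul_comm oddLog, coeff_mul, sum_smul, ← sum_add_distrib]
  apply sum_congr rfl
  intro p hp
  obtain rfl := HasAntidiagonal.mem_antidiagonal.mp hp
  rw [coeff_mk, coeff_mk, Prod.fst_swap, Prod.snd_swap, mul_smul_comm, h, smul_add, smul_smul,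
    smul_mul_assoc]
  congr 3
  push_cast; ring

theorem ShiftsBy.pow_mul_phiSeries (h : ShiftsBy A φ) (k : ℕ) (n : ℤ) (g : PowerSeries ℂ) :
    A ^ k * phiSeries φ n g =
      ∑ p ∈ antidiagonal k, k.choose p.1 • (phiSeries φ n (oddLog ^ p.1 * g) * A ^ p.2) := by
  induction k generalizing g with
  | zero => simp
  | succ k ih =>
    rw [sum_antidiagonal_choose_succ_nsmul
      (fun i j => phiSeries φ n (oddLog ^ i * g) * A ^ j), pow_succ, mul_assoc,
      h.mul_phiSeries, mul_add, ih, ← mul_assoc, ih, add_comm, sum_mul]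
    congr 1
    · apply sum_congr rfl
      intro p _
      rw [smul_mul_assoc, mul_assoc, pow_succ]
    · apply sum_congr rfl
      intro p hp
      rw [pow_succ, mul_assoc,
        Nat.choose_symm_of_eq_add (HasAntidiagonal.mem_antidiagonal.mp hp).symm]

theorem coeff_phiSeries_pow_mul {i k : ℕ} (h : k < i) (n : ℤ) (g : PowerSeries ℂ) :
    coeff k (phiSeries φ n (oddLog ^ i * g)) = 0 := by
  rw [phiSeries, coeff_mk, X_pow_dvd_iff.mp ((pow_dvd_pow_of_dvd
    (X_dvd_iff.mpr (by simpa using coeff_zero_oddLog)) i).mul_right g) k h, zero_smul]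

theorem coeff_phiSeries_expSeries {p N : ℕ} (h : p ≤ N) (n : ℤ) (g : PowerSeries ℂ) :
    coeff p (phiSeries φ n (expSeries oddLog * g)) =
      ∑ i ∈ range (N + 1), (i.factorial : ℂ)⁻¹ • coeff p (phiSeries φ n (oddLog ^ i * g)) := by
  simp only [phiSeries, coeff_mk, coeff_expSeries_mul coeff_zero_oddLog g h, sum_smul, smul_smul,
    smul_eq_mul]

/-- Conjugation by `exp A` acts on the series `phiSeries φ n g` as the multiplication of `g` by
`exp oddLog`. The operators `coeff i A` need not commute with each other. -/
theorem ShiftsBy.expSeries_mul_phiSeries (h : ShiftsBy A φ) (hA : coeff 0 A = 0) (n : ℤ)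
    (g : PowerSeries ℂ) :
    expSeries A * phiSeries φ n g =
      phiSeries φ n (expSeries oddLog * g) * expSeries A := by
  ext1 N
  have hl : coeff N (expSeries A * phiSeries φ n g) =
      ∑ k ∈ range (N + 1), ∑ p ∈ antidiagonal k, ((p.1.factorial : ℂ)⁻¹ * (p.2.factorial : ℂ)⁻¹) •
        coeff N (phiSeries φ n (oddLog ^ p.1 * g) * A ^ p.2) := by
    rw [coeff_expSeries_mul hA _ le_rfl]
    apply sum_congr rfl
    intro k _
    rw [h.pow_mul_phiSeries, map_sum, smul_sum]
    apply sum_congr rfl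
    intro p hp
    rw [← inv_factorial_mul_choose hp, map_nsmul, ← Nat.cast_smul_eq_nsmul ℂ, smul_smul]
  have hr : coeff N (phiSeries φ n (expSeries oddLog * g) * expSeries A) =
      ∑ i ∈ range (N + 1), ∑ j ∈ range (N + 1), ((i.factorial : ℂ)⁻¹ * (j.factorial : ℂ)⁻¹) •
        coeff N (phiSeries φ n (oddLog ^ i * g) * A ^ j) := by
    rw [coeff_mul_expSeries hA _ le_rfl, sum_comm]
    apply sum_congr rfl
    intro j _
    simp only [coeff_mul, smul_sum]
    rw [sum_comm]
    apply sum_congr rfl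
    intro p hp
    rw [coeff_phiSeries_expSeries (N := N) (by have := HasAntidiagonal.mem_antidiagonal.mp hp; omega),
      sum_mul,
      smul_sum]
    apply sum_congr rfl
    intro i _
    rw [smul_mul_assoc, smul_smul, mul_comm]
  rw [hl, hr]
  refine sum_triangle_eq_sum_square N (fun i j => ((i.factorial : ℂ)⁻¹ * (j.factorial : ℂ)⁻¹) •
    coeff N (phiSeries φ n (oddLog ^ i * g) * A ^ j)) ?_
  intro i j hij
  rw [coeff_mul, sum_eq_zero, smul_zero]
  intro p hp
  have := HasAntidiagonal.mem_antidiagonal.mp hp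
  rcases lt_or_ge p.1 i with hp1 | hp1
  · rw [coeff_phiSeries_pow_mul hp1, zero_mul]
  · rw [coeff_pow_of_lt hA (by omega), mul_zero]

theorem ShiftsBy.coeff_expSeries_commute (h : ShiftsBy A φ) (hA : coeff 0 A = 0) (n : ℤ)
    (N : ℕ) :
    coeff (N + 1) (expSeries A) * φ n - coeff N (expSeries A) * φ (n - 1) =
      φ n * coeff (N + 1) (expSeries A) + φ (n - 1) * coeff N (expSeries A) := by
  -- the choice `g = 1 - X` turns the infinite series into two terms on both sides
  have h := congrArg (coeff (N + 1)) (h.expSeries_mul_phiSeries hA n (1 - X))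
  rw [expSeries_oddLog] at h
  have h1 : phiSeries φ n (1 - X) = C (φ n) - C (φ (n - 1)) * X := by
    ext1 k
    rcases k with _ | _ | k <;> simp [phiSeries, coeff_one, coeff_X, coeff_C, coeff_succ_mul_X]
  have h2 : phiSeries φ n (1 + X) = C (φ n) + X * C (φ (n - 1)) := by
    ext1 k
    rcases k with _ | _ | k <;>
      simp [phiSeries, coeff_one, coeff_X]
  rw [h1, h2, mul_sub, add_mul, map_sub, map_add, ← mul_assoc, coeff_succ_mul_X, mul_assoc X,
    coeff_succ_X_mul] at h
  simpa using h

end Intertwining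

theorem coeff_zero_evolution (s : ℤ) : coeff 0 (evolution s) = 0 := by simp [evolution]

theorem shiftsBy_evolution : ShiftsBy (evolution 1) phi := by
  intro i l
  simp only [evolution, oddLog, coeff_mk, one_mul]
  split_ifs with h
  · apply LinearMap.ext
    intro x
    have := lambda_phi (m := (i : ℤ)) (by exact_mod_cast h) l x
    simp only [Module.End.mul_apply, LinearMap.smul_apply, LinearMap.add_apply, map_smul,
      this, smul_add]
  · simp

theorem expSeries_evolution_phi (n : ℤ) (N : ℕ) (x : Fock) :
    coeff (N + 1) (expSeries (evolution 1)) (phi n x) =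
      coeff N (expSeries (evolution 1)) (phi (n - 1) x) +
        phi n (coeff (N + 1) (expSeries (evolution 1)) x) +
        phi (n - 1) (coeff N (expSeries (evolution 1)) x) := by
  have h := congrArg (fun A : Module.End ℂ Fock => A x)
    (shiftsBy_evolution.coeff_expSeries_commute (coeff_zero_evolution 1) n N)
  rw [add_assoc]
  exact sub_eq_iff_eq_add'.mp h

/-- The relation `Γ̂₊(z) (φ_n - z⁻¹ φ_{n-1}) = (φ_n + z⁻¹ φ_{n-1}) Γ̂₊(z)` at `z^k`. -/
theorem gammaPlus_phi (k n : ℤ) (x : Fock) :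
    gammaPlus k (phi n x) = gammaPlus (k + 1) (phi (n - 1) x) + phi n (gammaPlus k x) +
      phi (n - 1) (gammaPlus (k + 1) x) := by
  have h0 : coeff 0 (expSeries (evolution 1)) = 1 := by simp [expSeries]
  rcases lt_trichotomy k 0 with hk | rfl | hk
  · obtain ⟨N, rfl⟩ : ∃ N : ℕ, k = -(N + 1 : ℤ) := ⟨(-k - 1).toNat, by omega⟩
    rw [gammaPlus, gammaPlus, if_pos (by omega), if_pos (by omega),
      show (-(N + 1 : ℤ)).natAbs = N + 1 by omega, show (-(N + 1 : ℤ) + 1).natAbs = N by omega,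
      expSeries_evolution_phi]
  · simp [gammaPlus, h0]
  · rw [gammaPlus, gammaPlus, if_neg (by omega), if_neg (by omega)]
    simp

theorem gammaPlus_vac (k : ℤ) (b : Bool) :
    gammaPlus k (vac b) = if k = 0 then vac b else 0 := by
  have hA : ∀ i, coeff i (evolution 1) (vac b) = 0 := by
    intro i
    simp only [evolution, coeff_mk]
    split_ifs with h
    · rw [LinearMap.smul_apply, lambda_vac (by have := h.pos; omega), smul_zero]
    · simp
  have hP : ∀ j i : ℕ, (coeff i (evolution 1 ^ (j + 1)) : Module.End ℂ Fock) (vac b) = 0 := by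
    intro j i
    rw [pow_succ, coeff_mul, LinearMap.sum_apply]
    exact sum_eq_zero fun p _ => by rw [Module.End.mul_apply, hA, map_zero]
  unfold gammaPlus
  split_ifs with h1 h2 h2
  · subst h2; simp [expSeries]
  · rw [expSeries, coeff_mk, sum_range_succ', LinearMap.add_apply, LinearMap.sum_apply]
    simp [hP, coeff_one, h2]
  · omega
  · simp

/-! ### The two vertex operators are transposes of each other -/

theorem pairing_coeff_evolution (n : ℕ) (x y : Fock) :
    pairing (coeff n (evolution 1) x) y = pairing x (coeff n (evolution (-1)) y) := by
  simp only [evolution, coeff_mk]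
  split_ifs with h
  · simp only [LinearMap.smul_apply, map_smul, smul_eq_mul]
    rw [pairing_lambda (by simpa using h)]
    simp
  · simp

theorem pairing_coeff_evolution_pow (k n : ℕ) (x y : Fock) :
    pairing (coeff n (evolution 1 ^ k) x) y = pairing x (coeff n (evolution (-1) ^ k) y) := by
  induction k generalizing n x y with
  | zero => simp only [pow_zero, coeff_one]; split_ifs <;> simp
  | succ k ih =>
    rw [pow_succ, pow_succ', coeff_mul, coeff_mul, ← Nat.sum_antidiagonal_swap]
    simp only [LinearMap.sum_apply, map_sum, Module.End.mul_apply, ih, pairing_coeff_evolution]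
    rfl

theorem pairing_gammaPlus (k : ℤ) (x y : Fock) :
    pairing (gammaPlus (-k) x) y = pairing x (gammaMinus k y) := by
  unfold gammaPlus gammaMinus
  simp only [Left.neg_nonpos_iff]
  split_ifs
  · simp only [expSeries, coeff_mk, LinearMap.sum_apply, map_sum, LinearMap.smul_apply, map_smul,
      pairing_coeff_evolution_pow, Int.natAbs_neg]
  · simp

end NeutralFermion

namespace NeutralFermion

/-! ### Matrix elements between products of fermions -/

/-- The vector `φ_{m_1} ⋯ φ_{m_k} Ω`, for a list of labels `m_1, …, m_k` and one of the two vacua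
`Ω`. -/
def ketList (l : List ℕ) (b : Bool) : Fock := (l.map (fun m : ℕ => phi (m : ℤ))).prod (vac b)

theorem ketList_nil (b : Bool) : ketList [] b = vac b := rfl

theorem ketList_cons (m : ℕ) (l : List ℕ) (b : Bool) :
    ketList (m :: l) b = phi m (ketList l b) := by
  simp [ketList]

theorem phi_neg_ketList {n : ℕ} {l : List ℕ} (hl : ∀ m ∈ l, m < n) (hn : 0 < n) (b : Bool) :
    phi (-n) (ketList l b) = 0 := by
  induction l with
  | nil => exact phi_neg_vac (by omega) b
  | cons m l ih =>
    have := hl m (by simp)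
    rw [ketList_cons, phi_phi_of_ne (by omega), ih fun i hi => hl i (by simp [hi]), map_zero,
      neg_zero]

/-- Induction on the degree: each use of `gammaPlus_phi` either lowers `m` and the degree or moves
`φ_{-n}` past a fermion with which it anticommutes. -/
theorem phi_neg_gammaPlus_phi {m n : ℤ} (hmn : m < n) {x : Fock}
    (hx : ∀ k, phi (-n) (gammaPlus k x) = 0) (k : ℤ) :
    phi (-n) (gammaPlus k (phi m x)) = 0 := by
  obtain ⟨N, hN⟩ : ∃ N : ℕ, (-k + 1).toNat = N := ⟨_, rfl⟩
  induction N generalizing k m with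
  | zero => rw [gammaPlus, if_neg (by omega)]; simp
  | succ N ih =>
    rw [gammaPlus_phi, map_add, map_add, ih (by omega) (k + 1) (by omega),
      phi_phi_of_ne (by omega), phi_phi_of_ne (m := -n) (n := m - 1) (by omega), hx, hx]
    simp

/-- The vertex operator does not raise the largest label. -/
theorem phi_neg_gammaPlus_ketList {n : ℕ} {l : List ℕ} (hl : ∀ m ∈ l, m < n) (hn : 0 < n)
    (b : Bool) (k : ℤ) : phi (-n) (gammaPlus k (ketList l b)) = 0 := by
  induction l generalizing k with
  | nil =>
    rw [ketList_nil, gammaPlus_vac]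
    split_ifs
    · exact phi_neg_vac (by omega) b
    · simp
  | cons m l ih =>
    rw [ketList_cons]
    exact phi_neg_gammaPlus_phi (by exact_mod_cast hl m (by simp))
      (fun k => ih (fun i hi => hl i (by simp [hi])) k) k

theorem pairing_ketList_phi {n : ℕ} {l : List ℕ} (hl : ∀ m ∈ l, m < n) (hn : 0 < n)
    (b : Bool) (x : Fock) : pairing (ketList l b) (phi n x) = 0 := by
  rw [pairing_phi_right, phi_neg_ketList hl hn]; simp

theorem pairing_phi_phi {m : ℤ} {x : Fock} (hx : phi (-m) x = 0) (y : Fock) :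
    pairing (phi m x) (phi m y) = pairing x y := by
  rw [pairing_phi_left, phi_phi_apply, map_sub, pairing_phi_right m x, hx, if_pos (by omega),
    map_smul, smul_eq_mul, neg_one_zpow_neg, map_zero, LinearMap.zero_apply, mul_zero, sub_zero,
    ← mul_assoc, neg_one_zpow_mul_self, one_mul]

/-- The coefficient of the matrix element of `Γ̂₊(z)` between the vectors of two decreasing lists
of positive labels, the final one first, and of the vacua `p`, `q`. An entry `n` of the final list
has the weight `1` if it equals one of the two entries `m`, `m'` of the initial list that enclose
it, and the weight `2` if it lies strictly between them. -/
def weight (p q : Bool) : List ℕ → List ℕ → ℂ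
  | [], [] => if p = q then 1 else 0
  | [], _ :: μ => if μ = [] ∧ p ≠ q then ((Real.sqrt 2 : ℝ) : ℂ) else 0
  | _ :: _, [] => 0
  | n :: ν, m :: μ =>
    if n ≤ m ∧ μ.headD 0 ≤ n then (if n = m ∨ n = μ.headD 0 then 1 else 2) * weight p q ν μ else 0

theorem weight_cons_cons (p q : Bool) (n m : ℕ) (ν μ : List ℕ) :
    weight p q (n :: ν) (m :: μ) = if n ≤ m ∧ μ.headD 0 ≤ n then
      (if n = m ∨ n = μ.headD 0 then 1 else 2) * weight p q ν μ else 0 := rfl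

theorem two_mul_sqrt_two_inv :
    2 * ((Real.sqrt 2 : ℝ) : ℂ)⁻¹ = ((Real.sqrt 2 : ℝ) : ℂ) := by
  have h : ((Real.sqrt 2 : ℝ) : ℂ) * ((Real.sqrt 2 : ℝ) : ℂ) = 2 := by
    rw [← Complex.ofReal_mul, Real.mul_self_sqrt (by norm_num)]; norm_num
  have h0 : ((Real.sqrt 2 : ℝ) : ℂ) ≠ 0 := by
    intro h0; rw [h0] at h; norm_num at h
  field_simp
  rw [pow_two, h]

theorem headD_le {l : List ℕ} {c : ℕ} (h : ∀ i ∈ l, i ≤ c) : l.headD 0 ≤ c := by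
  cases l with
  | nil => simp
  | cons a l => exact h a (by simp)

/-- The matrix elements of `Γ̂₊(z)` satisfy the recursion of the weights. The outer induction removes
the largest label of the initial state, the inner one lowers it by one with `gammaPlus_phi`. -/
theorem pairing_gammaPlus_ketList (p q : Bool) (ν μ : List ℕ) (hν : ∀ n ∈ ν, 0 < n)
    (hν' : ν.Pairwise (· > ·)) (hμ : ∀ n ∈ μ, 0 < n) (hμ' : μ.Pairwise (· > ·)) (k : ℤ) :
    pairing (ketList ν p) (gammaPlus k (ketList μ q)) =
      if k + μ.sum = ν.sum then weight p q ν μ else 0 := by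
  induction μ generalizing ν k with
  | nil =>
    rcases ν with _ | ⟨n, ν⟩
    · simp only [ketList_nil, gammaPlus_vac, weight]
      by_cases hk : k = 0 <;> simp [hk, pairing_vac]
    · rw [ketList_cons, pairing_phi_left, phi_neg_gammaPlus_ketList (by simp) (hν n (by simp))]
      simp [weight]
  | cons m μ ih =>
    obtain ⟨hμm, hμs⟩ := List.pairwise_cons.mp hμ'
    have hμp : ∀ n ∈ μ, 0 < n := fun n hn => hμ n (by simp [hn])
    -- the final list is empty or starts with an entry `≥ m`
    have hge : ∀ m : ℕ, 1 ≤ m → (∀ i ∈ μ, i < m) → ∀ (n : ℕ) (ν : List ℕ) (k : ℤ), m ≤ n →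
        (∀ i ∈ ν, 0 < i) → (n :: ν).Pairwise (· > ·) →
        pairing (ketList (n :: ν) p) (gammaPlus k (ketList (m :: μ) q)) =
          if k + (m :: μ).sum = (n :: ν).sum then weight p q (n :: ν) (m :: μ) else 0 := by
      intro m hm hμm n ν k hn hν hν'
      obtain ⟨hνn, hνs⟩ := List.pairwise_cons.mp hν'
      rcases hn.eq_or_lt with rfl | hn
      · have hx := phi_neg_ketList hνn hm p
        rw [ketList_cons m ν, ketList_cons m μ, gammaPlus_phi, map_add, map_add,
          pairing_phi_phi hx, ih ν hν hνs hμp hμs, pairing_phi_left,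
          phi_neg_gammaPlus_phi (by omega) (phi_neg_gammaPlus_ketList hμm hm q),
          pairing_phi_left, phi_phi_of_ne (by omega), phi_neg_gammaPlus_ketList hμm hm q]
        have hw : weight p q (m :: ν) (m :: μ) = weight p q ν μ := by
          have := headD_le (c := m) fun i hi => (hμm i hi).le
          rw [weight_cons_cons, if_pos ⟨le_rfl, this⟩, if_pos (Or.inl rfl), one_mul]
        have hs : k + μ.sum = ν.sum ↔ k + (m :: μ).sum = (m :: ν).sum := by
          simp only [List.sum_cons]; push_cast; omega
        simp only [hw, hs, map_zero, neg_zero, mul_zero, add_zero, zero_add]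
      · rw [ketList_cons, pairing_phi_left, phi_neg_gammaPlus_ketList _ (by omega)]
        · simp [weight, hn]
        · intro i hi
          rcases List.mem_cons.mp hi with rfl | hi
          · exact hn
          · exact (hμm i hi).trans hn
    have hm := hμ m (by simp)
    clear hμ hμ'
    induction m, hm using Nat.le_induction generalizing ν k with
    | base =>
      have hμ0 : μ = [] := List.eq_nil_iff_forall_not_mem.mpr fun i hi => by
        have := hμm i hi; have := hμp i hi; omega
      subst hμ0
      rcases ν with _ | ⟨n, ν⟩
      · rw [ketList_cons, gammaPlus_phi, map_add, map_add, pairing_ketList_phi (by simp) (by simp)]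
        simp only [ketList_nil, Nat.cast_one, sub_self, phi_zero_vac, map_smul, gammaPlus_vac]
        have hc : k + ((List.sum [Nat.succ 0] : ℕ) : ℤ) = ((List.sum ([] : List ℕ) : ℕ) : ℤ) ↔
            k + 1 = 0 := by simp
        simp only [hc]
        have hw : weight p q [] [Nat.succ 0] =
            ((Real.sqrt 2 : ℝ) : ℂ)⁻¹ * pairing (vac p) (vac (!q)) +
              ((Real.sqrt 2 : ℝ) : ℂ)⁻¹ * pairing (vac p) (vac (!q)) := by
          have h2 := two_mul_sqrt_two_inv
          rw [two_mul] at h2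
          rw [weight, pairing_vac]
          cases p <;> cases q <;> simp [h2]
        by_cases hk : k + 1 = 0
        · rw [if_pos hk, if_pos hk, if_pos hk, phi_zero_vac, map_smul, hw, add_zero]
          rfl
        · simp [hk]
      · exact hge 1 le_rfl hμm n ν k (hν n (by simp)) (fun i hi => hν i (by simp [hi])) hν'
    | succ m hm ihm =>
      by_cases hνm : ∀ n ∈ ν, n < m + 1
      swap
      · rcases ν with _ | ⟨n, ν⟩
        · simp at hνm
        · refine hge (m + 1) (by omega) hμm n ν k ?_ (fun i hi => hν i (by simp [hi])) hν'
          by_contra hn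
          apply hνm
          intro i hi
          rcases List.mem_cons.mp hi with rfl | hi
          · omega
          · have := (List.pairwise_cons.mp hν').1 i hi; omega
      have hcast : ((m + 1 : ℕ) : ℤ) - 1 = m := by push_cast; ring
      rw [ketList_cons, gammaPlus_phi, map_add, map_add, pairing_ketList_phi hνm (by omega), hcast,
        add_zero]
      -- either `φ_m φ_{μ_1} φ_{μ_2} ⋯` is again a decreasing product, or it starts with
      -- `φ_m φ_m = 0`
      have hT : (μ.headD 0 < m ∧ pairing (ketList ν p) (gammaPlus (k + 1) (phi m (ketList μ q))) =
            if k + ((m + 1) :: μ).sum = ν.sum then weight p q ν (m :: μ) else 0) ∨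
          (μ.headD 0 = m ∧ μ ≠ [] ∧
            pairing (ketList ν p) (gammaPlus (k + 1) (phi m (ketList μ q))) = 0) := by
        by_cases hμ' : ∀ i ∈ μ, i < m
        · left
          constructor
          · have := headD_le (c := m - 1) (l := μ) fun i hi => by have := hμ' i hi; omega
            omega
          · rw [← ketList_cons, ihm ν hν hν' (k + 1) hμ']
            have : k + 1 + (m :: μ).sum = ν.sum ↔ k + ((m + 1) :: μ).sum = ν.sum := by
              simp only [List.sum_cons]; push_cast; omega
            simp only [this]
        · right
          rcases μ with _ | ⟨a, μ⟩
          · simp at hμ'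
          · have ha : a = m := by
              have h1 := hμm a (by simp)
              by_contra h
              apply hμ'
              intro i hi
              rcases List.mem_cons.mp hi with rfl | hi
              · omega
              · have := (List.pairwise_cons.mp hμs).1 i hi; omega
            subst ha
            refine ⟨rfl, by simp, ?_⟩
            rw [ketList_cons, phi_phi_self (by omega)]; simp
      rcases ν with _ | ⟨n, ν⟩
      · rw [pairing_ketList_phi (by simp) (by omega), add_zero]
        rcases hT with ⟨_, h2⟩ | ⟨_, h1, h2⟩
        · rw [h2]; rfl
        · rw [h2]; simp [weight, h1]
      · have hn := hνm n (by simp)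
        obtain ⟨hνn, hνs⟩ := List.pairwise_cons.mp hν'
        rcases (Nat.lt_succ_iff.mp hn).eq_or_lt with rfl | hn'
        -- the label `m` of the final state can be met by both terms of `gammaPlus_phi`; the first one
        -- is lost if `m` is also a label of the initial state
        · have h3 : pairing (ketList (n :: ν) p) (phi n (gammaPlus (k + 1) (ketList μ q))) =
              if k + ((n + 1) :: μ).sum = (n :: ν).sum then weight p q ν μ else 0 := by
            rw [ketList_cons, pairing_phi_phi (phi_neg_ketList hνn hm p),
              ih ν (fun i hi => hν i (by simp [hi])) hνs hμp hμs]
            have : k + 1 + μ.sum = ν.sum ↔ k + ((n + 1) :: μ).sum = (n :: ν).sum := by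
              simp only [List.sum_cons]; push_cast; omega
            simp only [this]
          rw [h3]
          rcases hT with ⟨h1, h2⟩ | ⟨h1, _, h2⟩
          · have w1 : weight p q (n :: ν) (n :: μ) = weight p q ν μ := by
              rw [weight_cons_cons, if_pos ⟨le_rfl, h1.le⟩, if_pos (Or.inl rfl), one_mul]
            have w2 : weight p q (n :: ν) ((n + 1) :: μ) = 2 * weight p q ν μ := by
              rw [weight_cons_cons, if_pos ⟨n.le_succ, h1.le⟩, if_neg (by omega)]
            rw [h2, w1, w2]
            split_ifs
            · ring
            · simp
          · have w : weight p q (n :: ν) ((n + 1) :: μ) = weight p q ν μ := by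
              rw [weight_cons_cons, if_pos ⟨n.le_succ, h1.le⟩, if_pos (Or.inr h1.symm), one_mul]
            rw [h2, w, zero_add]
        · rw [pairing_ketList_phi _ (by omega), add_zero]
          · rcases hT with ⟨h1, h2⟩ | ⟨h1, _, h2⟩
            · simp only [h2, weight_cons_cons, hn'.le, hn.le, hn'.ne, hn.ne, true_and, false_or]
            · have w : weight p q (n :: ν) ((m + 1) :: μ) = 0 := by
                rw [weight_cons_cons, if_neg (by omega)]
              rw [h2, w, ite_self]
          · intro i hi
            rcases List.mem_cons.mp hi with rfl | hi
            · exact hn'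
            · exact (hνn i hi).trans hn'

end NeutralFermion

namespace NeutralFermion

/-! ### Interlacing of decreasing lists -/

/-- The interlacing `μ₁ ≥ ν₁ ≥ μ₂ ≥ ν₂ ≥ …` of two lists continued by zeros. -/
def ListInterlaces (ν μ : List ℕ) : Prop :=
  ∀ j : ℕ, ν.getD j 0 ≤ μ.getD j 0 ∧ μ.getD (j + 1) 0 ≤ ν.getD j 0

theorem listInterlaces_cons {n m : ℕ} {ν μ : List ℕ} :
    ListInterlaces (n :: ν) (m :: μ) ↔ (n ≤ m ∧ μ.headD 0 ≤ n) ∧ ListInterlaces ν μ := by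
  have h0 : μ.headD 0 = μ.getD 0 0 := by cases μ <;> rfl
  rw [h0]
  constructor
  · exact fun h => ⟨h 0, fun j => h (j + 1)⟩
  · rintro ⟨h1, h2⟩ (_ | j)
    · exact h1
    · exact h2 j

theorem listInterlaces_nil_left {μ : List ℕ} (hμ : ∀ m ∈ μ, 0 < m) :
    ListInterlaces [] μ ↔ μ.length ≤ 1 := by
  rcases μ with _ | ⟨a, _ | ⟨b, μ⟩⟩
  · simp [ListInterlaces]
  · simp [ListInterlaces]
  · simp only [List.length_cons]
    constructor
    · intro h
      have h1 := (h 0).2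
      have h2 := hμ b (by simp)
      simp at h1
      omega
    · omega

theorem not_listInterlaces_nil_right {n : ℕ} {ν : List ℕ} (hn : 0 < n) :
    ¬ ListInterlaces (n :: ν) [] := by
  intro h
  have := (h 0).1
  simp at this
  omega

/-- The number of entries of the first list that are not entries of the second one. -/
def listNew (ν μ : List ℕ) : ℕ := (ν.filter (fun n => n ∉ μ)).length

theorem listNew_cons {n m : ℕ} {ν μ : List ℕ} (hν : ∀ i ∈ ν, i < n) (hμ : ∀ i ∈ μ, i ≤ μ.headD 0)
    (h : n ≤ m ∧ μ.headD 0 ≤ n) (hn : 0 < n) :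
    listNew (n :: ν) (m :: μ) = (if n = m ∨ n = μ.headD 0 then 0 else 1) + listNew ν μ := by
  have h1 : n ∈ m :: μ ↔ n = m ∨ n = μ.headD 0 := by
    rw [List.mem_cons]
    refine or_congr_right ⟨fun hm => le_antisymm (hμ n hm) h.2, fun he => ?_⟩
    cases μ with
    | nil => simp at he; omega
    | cons a μ => simp [he]
  have h2 : ν.filter (fun i => i ∉ m :: μ) = ν.filter (fun i => i ∉ μ) := by
    apply List.filter_congr
    intro i hi
    have := hν i hi
    simp only [List.mem_cons, not_or, show i ≠ m by omega, not_false_eq_true, true_and]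
  unfold listNew
  rw [List.filter_cons, h2]
  by_cases hc : n = m ∨ n = μ.headD 0
  · rw [if_pos hc, if_neg (by simpa only [decide_eq_true_eq, not_not] using h1.mpr hc), zero_add]
  · rw [if_neg hc, if_pos (by simpa only [decide_eq_true_eq] using fun h => hc (h1.mp h)),
      List.length_cons, add_comm]

/-- The closed form of the recursively defined weight. -/
theorem weight_eq (p q : Bool) (ν μ : List ℕ) (hν : ∀ n ∈ ν, 0 < n)
    (hν' : ν.Pairwise (· > ·)) (hμ : ∀ n ∈ μ, 0 < n) (hμ' : μ.Pairwise (· > ·)) :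
    (ListInterlaces ν μ → ν.length = μ.length →
      weight p q ν μ = if p = q then 2 ^ listNew ν μ else 0) ∧
    (ListInterlaces ν μ → ν.length + 1 = μ.length →
      weight p q ν μ = if p = q then 0 else 2 ^ listNew ν μ * ((Real.sqrt 2 : ℝ) : ℂ)) ∧
    (¬ (ListInterlaces ν μ ∧ (ν.length = μ.length ∨ ν.length + 1 = μ.length)) →
      weight p q ν μ = 0) := by
  induction ν generalizing μ with
  | nil =>
    rw [listInterlaces_nil_left hμ]
    rcases μ with _ | ⟨a, _ | ⟨b, μ⟩⟩
    · simp [weight, listNew]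
    · simp [weight, listNew]
    · simp [weight, listNew]
  | cons n ν ih =>
    have hn := hν n (by simp)
    rcases μ with _ | ⟨m, μ⟩
    · simp [weight, not_listInterlaces_nil_right hn]
    · obtain ⟨hνn, hνs⟩ := List.pairwise_cons.mp hν'
      obtain ⟨hμm, hμs⟩ := List.pairwise_cons.mp hμ'
      obtain ⟨i1, i2, i3⟩ := ih μ (fun i hi => hν i (by simp [hi])) hνs
        (fun i hi => hμ i (by simp [hi])) hμs
      rw [listInterlaces_cons, weight_cons_cons]
      have hl1 : (n :: ν).length = (m :: μ).length ↔ ν.length = μ.length := by simp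
      have hl2 : (n :: ν).length + 1 = (m :: μ).length ↔ ν.length + 1 = μ.length := by simp
      rw [hl1, hl2]
      by_cases hc : n ≤ m ∧ μ.headD 0 ≤ n
      · have hhead : ∀ i ∈ μ, i ≤ μ.headD 0 := by
          rcases μ with _ | ⟨a, μ⟩
          · simp
          · intro i hi
            rcases List.mem_cons.mp hi with rfl | hi
            · exact le_rfl
            · exact ((List.pairwise_cons.mp hμs).1 i hi).le
        have hw : (2 : ℂ) ^ listNew (n :: ν) (m :: μ) =
            (if n = m ∨ n = μ.headD 0 then 1 else 2) * 2 ^ listNew ν μ := by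
          rw [listNew_cons hνn hhead hc hn, pow_add]
          split_ifs <;> simp
        rw [if_pos hc, hw]
        refine ⟨fun h hl => ?_, fun h hl => ?_, fun h => ?_⟩
        · rw [i1 h.2 hl]; split_ifs <;> simp
        · rw [i2 h.2 hl]; split_ifs <;> ring
        · rw [i3 (fun h' => h ⟨⟨hc, h'.1⟩, h'.2⟩), mul_zero]
      · rw [if_neg hc]
        exact ⟨fun h => absurd h.1 hc, fun h => absurd h.1 hc, fun _ => rfl⟩

/-! ### Strict partitions -/

namespace StrictPartition

variable (μ ν : StrictPartition)

/-- The nonzero parts in decreasing order. -/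
def partList : List ℕ := μ.parts.sort (· ≥ ·)

theorem mem_partList {n : ℕ} : n ∈ μ.partList ↔ n ∈ μ.parts := by simp [partList]

theorem partList_pos : ∀ n ∈ μ.partList, 0 < n := fun n hn => μ.pos n (μ.mem_partList.mp hn)

theorem partList_pairwise : μ.partList.Pairwise (· > ·) :=
  (Finset.sortedGT_sort μ.parts).pairwise

theorem length_partList : μ.partList.length = μ.length := by simp [partList, length]

theorem sum_partList : μ.partList.sum = μ.size := by
  have h : μ.partList.toFinset = μ.parts := Finset.sort_toFinset ..
  have := List.sum_toFinset (fun m : ℕ => m) (Finset.sort_nodup μ.parts (· ≥ ·))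
  rw [Finset.sort_toFinset] at this
  simpa [size, partList] using this.symm

theorem interlaces_iff : ν.Interlaces μ ↔ ListInterlaces ν.partList μ.partList := Iff.rfl

theorem listNew_partList : listNew ν.partList μ.partList = ν.newParts μ := by
  rw [listNew, newParts, ← List.toFinset_card_of_nodup]
  · congr 1
    ext n
    simp [mem_partList]
  · exact (Finset.sort_nodup _ _).filter _

/-- Whether a zero label has to be added to the nonzero parts. -/
def isOdd : Bool := decide (Odd μ.length)

theorem sort_labels : μ.labels.sort (· ≥ ·) = μ.partList ++ if μ.isOdd then [0] else [] := by
  have h0 : 0 ∉ μ.parts := fun h => lt_irrefl _ (μ.pos 0 h)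
  unfold labels isOdd length
  by_cases h : Even μ.parts.card
  · simp [h, partList]
  · rw [if_neg h, if_pos (by simpa using h)]
    apply List.Perm.eq_of_pairwise (le := (· ≥ ·))
    · intro a b _ _ h1 h2; exact le_antisymm h2 h1
    · exact Finset.pairwise_sort _ _
    · rw [List.pairwise_append]
      refine ⟨Finset.pairwise_sort _ _, by simp, by simp⟩
    · rw [List.perm_ext_iff_of_nodup (Finset.sort_nodup _ _)]
      · intro a; simp [mem_partList, or_comm]
      · rw [List.nodup_append]
        refine ⟨Finset.sort_nodup _ _, by simp, ?_⟩
        intro a ha b hb hab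
        simp at hb
        exact h0 (μ.mem_partList.mp (by rwa [← hb, ← hab]))

theorem r_eq : μ.r = (μ.length + 1) / 2 := by
  have h0 : 0 ∉ μ.parts := fun h => lt_irrefl _ (μ.pos 0 h)
  unfold r labels length
  split_ifs with h
  · obtain ⟨k, hk⟩ := h; omega
  · rw [Finset.card_insert_of_notMem h0]

theorem ket_eq : μ.ket = ((-1 : ℂ) ^ μ.r) • ketList μ.partList μ.isOdd := by
  have h0 : 0 ∉ μ.parts := fun h => lt_irrefl _ (μ.pos 0 h)
  have hs : ((Real.sqrt 2 : ℝ) : ℂ) ≠ 0 := by simp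
  rw [ket, sort_labels, List.map_append, List.prod_append, Module.End.mul_apply, mul_comm, mul_smul,
    ← map_smul, ketList]
  congr 2
  unfold alpha labels isOdd length
  by_cases h : Even μ.parts.card
  · simp [h, h0, vac, vacuum, Nat.not_odd_iff_even.mpr h]
  · have h' := Nat.not_even_iff_odd.mp h
    have : vacuum = vac false := rfl
    simp [h', this, phi_zero_vac, smul_smul, hs, h]

theorem pairing_prod_phi (l : List ℕ) (v x : Fock) :
    pairing ((l.map (fun m : ℕ => phi (m : ℤ))).prod v) x = (-1) ^ l.sum *
      pairing v ((l.reverse.map (fun m : ℕ => phi (-(m : ℤ)))).prod x) := by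
  induction l generalizing x with
  | nil => simp
  | cons m l ih =>
    rw [List.map_cons, List.prod_cons, Module.End.mul_apply, pairing_phi_left, ih,
      List.reverse_cons, List.map_append, List.prod_append, Module.End.mul_apply, List.sum_cons,
      pow_add, zpow_natCast]
    simp [mul_assoc]

theorem sort_le_eq_reverse (s : Finset ℕ) : s.sort (· ≤ ·) = (s.sort (· ≥ ·)).reverse := by
  apply List.Perm.eq_of_pairwise (le := (· ≤ ·))
  · intro a b _ _ h1 h2; exact le_antisymm h1 h2
  · exact Finset.pairwise_sort _ _
  · rw [List.pairwise_reverse]; exact Finset.pairwise_sort _ _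
  · rw [List.perm_ext_iff_of_nodup (Finset.sort_nodup _ _)
      (List.nodup_reverse.mpr (Finset.sort_nodup _ _))]
    simp

/-- The final state of a strict partition is the transpose of its initial state. -/
theorem bra_eq : μ.bra = pairing μ.ket := by
  apply LinearMap.ext
  intro x
  have hsum : (μ.labels.sort (· ≥ ·)).sum = μ.size := by
    rw [sort_labels, List.sum_append, sum_partList]; split_ifs <;> simp
  rw [bra, ket, map_smul, LinearMap.smul_apply, LinearMap.smul_apply, pairing_prod_phi, hsum,
    sort_le_eq_reverse, pairing_vacuum, pow_add, smul_eq_mul, smul_eq_mul, LinearMap.comp_apply]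
  ring

theorem bra_gammaPlus_ket :
    matrixElement ν.bra gammaPlus μ.ket = monomial ((ν.size : ℤ) - μ.size)
      ((-1) ^ (ν.r + μ.r) * weight ν.isOdd μ.isOdd ν.partList μ.partList) := by
  funext k
  have hk : k + (μ.size : ℤ) = ν.size ↔ k = (ν.size : ℤ) - μ.size := by omega
  rw [matrixElement, bra_eq, ket_eq, ket_eq, map_smul, map_smul, map_smul, LinearMap.smul_apply,
    pairing_gammaPlus_ketList _ _ _ _ ν.partList_pos ν.partList_pairwise μ.partList_pos
      μ.partList_pairwise, sum_partList, sum_partList, monomial, Pi.single_apply, pow_add]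
  simp only [hk, smul_eq_mul]
  split_ifs
  · ring
  · simp

theorem bra_gammaMinus_ket (k : ℤ) :
    matrixElement μ.bra gammaMinus ν.ket k = matrixElement ν.bra gammaPlus μ.ket (-k) := by
  rw [matrixElement, matrixElement, bra_eq, bra_eq, ← pairing_gammaPlus, pairing_comm]

theorem weight_partList :
    (ν.Interlaces μ → ν.length = μ.length →
      (-1) ^ (ν.r + μ.r) * weight ν.isOdd μ.isOdd ν.partList μ.partList = 2 ^ ν.newParts μ) ∧
    (ν.Interlaces μ → ν.length + 1 = μ.length →
      (-1) ^ (ν.r + μ.r) * weight ν.isOdd μ.isOdd ν.partList μ.partList =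
        (-1) ^ μ.length * (2 ^ ν.newParts μ * ((Real.sqrt 2 : ℝ) : ℂ))) ∧
    (¬ (ν.Interlaces μ ∧ (ν.length = μ.length ∨ ν.length + 1 = μ.length)) →
      (-1) ^ (ν.r + μ.r) * weight ν.isOdd μ.isOdd ν.partList μ.partList = 0) := by
  obtain ⟨h1, h2, h3⟩ := weight_eq ν.isOdd μ.isOdd _ _ ν.partList_pos ν.partList_pairwise
    μ.partList_pos μ.partList_pairwise
  simp only [length_partList, ← interlaces_iff, listNew_partList] at h1 h2 h3
  refine ⟨fun h hl => ?_, fun h hl => ?_, fun h => ?_⟩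
  · rw [h1 h hl, if_pos (by rw [isOdd, isOdd, hl]), r_eq, r_eq, hl, ← two_mul, pow_mul]
    simp
  · have hne : ν.isOdd ≠ μ.isOdd := by
      rw [isOdd, isOdd, ← hl]
      simp only [ne_eq, decide_eq_decide, Nat.odd_add_one]
      tauto
    rw [h2 h hl, if_neg hne, r_eq, r_eq, show (ν.length + 1) / 2 + (μ.length + 1) / 2 = μ.length by
      omega]
  · rw [h3 h, mul_zero]

end StrictPartition

end NeutralFermion

open NeutralFermion
theorem lemma2 (μ ν : NeutralFermion.StrictPartition) :
    -- the matrix element of the first vertex operator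
    ((ν.Interlaces μ → ν.length = μ.length →
        NeutralFermion.matrixElement ν.bra NeutralFermion.gammaPlus μ.ket =
          NeutralFermion.monomial ((ν.size : ℤ) - (μ.size : ℤ)) (2 ^ ν.newParts μ)) ∧
      (ν.Interlaces μ → ν.length + 1 = μ.length →
        NeutralFermion.matrixElement ν.bra NeutralFermion.gammaPlus μ.ket =
          NeutralFermion.monomial ((ν.size : ℤ) - (μ.size : ℤ))
            ((-1) ^ μ.length * (2 ^ ν.newParts μ * ((Real.sqrt 2 : ℝ) : ℂ)))) ∧
      (¬ (ν.Interlaces μ ∧ (ν.length = μ.length ∨ ν.length + 1 = μ.length)) →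
        NeutralFermion.matrixElement ν.bra NeutralFermion.gammaPlus μ.ket = 0)) ∧
    -- the matrix element of the second vertex operator
    ((ν.Interlaces μ → ν.length = μ.length →
        NeutralFermion.matrixElement μ.bra NeutralFermion.gammaMinus ν.ket =
          NeutralFermion.monomial ((μ.size : ℤ) - (ν.size : ℤ)) (2 ^ ν.newParts μ)) ∧
      (ν.Interlaces μ → ν.length + 1 = μ.length →
        NeutralFermion.matrixElement μ.bra NeutralFermion.gammaMinus ν.ket =
          NeutralFermion.monomial ((μ.size : ℤ) - (ν.size : ℤ))
            ((-1) ^ μ.length * (2 ^ ν.newParts μ * ((Real.sqrt 2 : ℝ) : ℂ)))) ∧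
      (¬ (ν.Interlaces μ ∧ (ν.length = μ.length ∨ ν.length + 1 = μ.length)) →
        NeutralFermion.matrixElement μ.bra NeutralFermion.gammaMinus ν.ket = 0)) := by

  have hp := StrictPartition.bra_gammaPlus_ket μ ν
  have hm : matrixElement μ.bra gammaMinus ν.ket = monomial ((μ.size : ℤ) - ν.size)
      ((-1) ^ (ν.r + μ.r) * weight ν.isOdd μ.isOdd ν.partList μ.partList) := by
    funext k
    have hk : -k = (ν.size : ℤ) - μ.size ↔ k = (μ.size : ℤ) - ν.size := by omega
    simp only [StrictPartition.bra_gammaMinus_ket, hp, monomial, Pi.single_apply, hk]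
  have h0 : ∀ k, monomial k 0 = 0 := fun k => Pi.single_zero k
  obtain ⟨h1, h2, h3⟩ := StrictPartition.weight_partList μ ν
  rw [hp, hm]
  exact ⟨⟨fun h hl => by rw [h1 h hl], fun h hl => by rw [h2 h hl], fun h => by rw [h3 h, h0]⟩,
    ⟨fun h hl => by rw [h1 h hl], fun h hl => by rw [h2 h hl], fun h => by rw [h3 h, h0]⟩⟩

end
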